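/- **Setting.** Let $n\ge 1$, $T>0$, $I=[0,T]$, $J=[0,2T]$, and let $a_0,\dots,a_{2n-1}\in L^\alpha(I)$ be real-valued, with $\alpha\ge 1$. For a compact interval $K$ let $W^{2n,1}(K)$ be the space of all $u\in C^{2n-1}(K)$ with $u^{(2n-1)}$ absolutely continuous. Consider $$Lu(t)=u^{(2n)}(t)+a_{2n-1}(t)u^{(2n-1)}(t)+\dots+a_1(t)u'(t)+a_0(t)u(t),\qquad t\in I,$$ and the operator $\widetilde L$ of the same form on $J$ whose coefficient of index $k$ is, for even $k$, the even and, for odd $k$, the odd extension of $a_k$ with respect to $t=T$ (that is, $(-1)^k a_k(2T-t)$ for $t\in(T,2T]$). An operator is called nonresonant in a space $X$ of functions if $0$ is the only function in $X$ that it maps to $0$ almost everywhere. Assume that $L$ is nonresonant in $$X_N=\{u\in W^{2n,1}(I): u^{(2k+1)}(0)=u^{(2k+1)}(T)=0,\ k=0,\dots,n-1\}$$ and in $$X_D=\{u\in W^{2n,1}(I): u^{(2k)}(0)=u^{(2k)}(T)=0,\ k=0,\dots,n-1\},$$ and that $\widetilde L$ is nonresonant in $$X_P=\{u\in W^{2n,1}(J):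 u^{(k)}(0)=u^{(k)}(2T),\ k=0,\dots,2n-1\}.$$ Let $G_P$ be the Green's function of $\widetilde L$ on $X_P$, that is, the function on $J\times J$ such that: $\partial_t^kG_P$ is continuous on $J\times J$ for $k\le 2n-2$; $\partial_t^{2n-1}G_P$ exists for $t\ne s$ and extends continuously to each of the closed triangles $s\le t$ and $t\le s$; and for every $s\in(0,2T)$ the function $\partial_t^{2n-1}G_P(\cdot,s)$ is absolutely continuous on $[0,s]$ and on $[s,2T]$ (with its one-sided limits at $s$), it jumps by $+1$ at $t=s$, $\widetilde L\,G_P(\cdot,s)=0$ a.e. on $J$, and $\partial_t^kG_P(0,s)=\partial_t^kG_P(2T,s)$ for $k=0,\dots,2n-1$. **Theorem.** Let $\sigma_1,\sigma_2\in L^1(I)$, let $u_N$ be the unique solution of $Lu=\sigma_1$ a.e. on $I$, $u\in X_N$, and let $u_D$ be the unique solution of $Lu=\sigma_2$ a.e. on $I$, $u\in X_D$. Then: 1. If $G_P\ge 0$ on $J\times J$ and $|\sigma_2(t)|\le\sigma_1(t)$ for a.e. $t\in I$, then $|u_D(t)|\le u_N(t)$ for all $t\in I$. 2. If $G_P\le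 0$ on $J\times J$ and $0\le\sigma_2(t)\le\sigma_1(t)$ for a.e. $t\in I$, then $u_N(t)\le 0$ and $u_N(t)\le u_D(t)$ for all $t\in I$. 3. If $G_P\le 0$ on $J\times J$ and $\sigma_1(t)\le\sigma_2(t)\le 0$ for a.e. $t\in I$, then $u_N(t)\ge 0$ and $u_D(t)\le u_N(t)$ for all $t\in I$. -/

import Mathlib

open Set MeasureTheory
open scoped ENNReal

noncomputable section

namespace EvenOrderBVP

/-- The `k`-th derivative of `u` on the interval `[0, b]` (one-sided at the end points). -/
def der (b : ℝ) (k : ℕ) (u : ℝ → ℝ) (t : ℝ) : ℝ :=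
  iteratedDerivWithin k u (Icc 0 b) t

/-- The operator `u ↦ u^(m) + a_{m-1} u^(m-1) + ⋯ + a_1 u' + a_0 u` on `[0, b]`. -/
def diffOp (m : ℕ) (b : ℝ) (a : ℕ → ℝ → ℝ) (u : ℝ → ℝ) (t : ℝ) : ℝ :=
  der b m u t + ∑ k ∈ Finset.range m, a k t * der b k u t

/-- The space `W^{m,1}([0, b])`, `m ≥ 1`: functions of class `C^{m-1}` on `[0, b]` whose
derivative of order `m - 1` is absolutely continuous on `[0, b]`. -/
def sobolevW (m : ℕ) (b : ℝ) : Set (ℝ → ℝ) :=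
  {u | ContDiffOn ℝ ((m - 1 : ℕ) : ℕ∞) u (Icc 0 b) ∧
    AbsolutelyContinuousOnInterval (der b (m - 1) u) 0 b}

/-- Neumann conditions on `[0, b]`: the derivatives of orders `1, 3, …, 2n - 1` vanish at both
end points. -/
def NeumannBC (n : ℕ) (b : ℝ) (u : ℝ → ℝ) : Prop :=
  ∀ k < n, der b (2 * k + 1) u 0 = 0 ∧ der b (2 * k + 1) u b = 0

/-- Dirichlet conditions on `[0, b]`: the derivatives of orders `0, 2, …, 2n - 2` vanish at both
end points. -/
def DirichletBC (n : ℕ) (b : ℝ) (u : ℝ → ℝ) : Prop :=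
  ∀ k < n, der b (2 * k) u 0 = 0 ∧ der b (2 * k) u b = 0

/-- Periodic conditions on `[0, b]` for the derivatives of orders `0, 1, …, 2n - 1`. -/
def PeriodicBC (n : ℕ) (b : ℝ) (u : ℝ → ℝ) : Prop :=
  ∀ k < 2 * n, der b k u 0 = der b k u b

/-- `u ∈ W^{m,1}([0, b])` satisfies the boundary conditions `BC` and solves the equation
`u^(m) + a_{m-1} u^(m-1) + ⋯ + a_0 u = σ` almost everywhere on `[0, b]`. -/
def IsSolution (m : ℕ) (b : ℝ) (a : ℕ → ℝ → ℝ) (BC : (ℝ → ℝ) → Prop)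
    (σ : ℝ → ℝ) (u : ℝ → ℝ) : Prop :=
  u ∈ sobolevW m b ∧ BC u ∧ ∀ᵐ t ∂(volume.restrict (Icc 0 b)), diffOp m b a u t = σ t

/-- The operator is nonresonant in the space of all `u ∈ W^{m,1}([0, b])` satisfying `BC`: the
homogeneous problem has only the trivial solution. -/
def Nonresonant (m : ℕ) (b : ℝ) (a : ℕ → ℝ → ℝ) (BC : (ℝ → ℝ) → Prop) : Prop :=
  ∀ u, IsSolution m b a BC (fun _ => 0) u → ∀ t ∈ Icc 0 b, u t = 0

/-- The extension to `[0, 2T]` of the coefficients given on `[0, T]`: with respect to `t = T`,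
even for the coefficients of even index and odd for those of odd index. -/
def extendCoeff (T : ℝ) (a : ℕ → ℝ → ℝ) (k : ℕ) (t : ℝ) : ℝ :=
  if t ≤ T then a k t else (-1) ^ k * a k (2 * T - t)

/-- `G` is the Green's function on `[0, b] × [0, b]` of the operator of order `m ≥ 2` with
coefficients `a` and (linear, homogeneous) boundary conditions `BC`. Here `Hₗ` and `Hᵤ` are the
derivative `∂ₜ^(m-1) G` on the triangles `s ≤ t` and `t ≤ s`, with its one-sided limits on the
diagonal. If the operator is nonresonant, `G` is determined on the whole square by these
conditions. -/
structure IsGreenFunction (m : ℕ) (b : ℝ) (a : ℕ → ℝ → ℝ) (BC : (ℝ → ℝ) → Prop)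
    (G : ℝ → ℝ → ℝ) : Prop where
  /-- `G(·, s)` is of class `C^(m-2)`. -/
  contDiffOn : ∀ s ∈ Icc 0 b, ContDiffOn ℝ ((m - 2 : ℕ) : ℕ∞) (fun t => G t s) (Icc 0 b)
  /-- `∂ₜ^k G`, `k ≤ m - 2`, is continuous on the square. -/
  continuousOn : ∀ k ≤ m - 2,
    ContinuousOn (fun p : ℝ × ℝ => der b k (fun t => G t p.2) p.1) (Icc 0 b ×ˢ Icc 0 b)
  /-- `∂ₜ^(m-1) G` exists off the diagonal, is continuous up to the diagonal on each of the two
  triangles, is absolutely continuous in `t` on either side of the diagonal, and jumps by `1`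
  across it. -/
  jump : ∃ Hₗ Hᵤ : ℝ → ℝ → ℝ,
    ContinuousOn (fun p : ℝ × ℝ => Hₗ p.1 p.2) {p | 0 ≤ p.2 ∧ p.2 ≤ p.1 ∧ p.1 ≤ b} ∧
    ContinuousOn (fun p : ℝ × ℝ => Hᵤ p.1 p.2) {p | 0 ≤ p.1 ∧ p.1 ≤ p.2 ∧ p.2 ≤ b} ∧
    (∀ t ∈ Icc 0 b, ∀ s ∈ Icc 0 b, s < t →
      HasDerivWithinAt (der b (m - 2) (fun r => G r s)) (Hₗ t s) (Icc 0 b) t) ∧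
    (∀ t ∈ Icc 0 b, ∀ s ∈ Icc 0 b, t < s →
      HasDerivWithinAt (der b (m - 2) (fun r => G r s)) (Hᵤ t s) (Icc 0 b) t) ∧
    (∀ s ∈ Ioo 0 b, AbsolutelyContinuousOnInterval (fun t => Hₗ t s) s b) ∧
    (∀ s ∈ Ioo 0 b, AbsolutelyContinuousOnInterval (fun t => Hᵤ t s) 0 s) ∧
    ∀ s ∈ Ioo 0 b, Hₗ s s - Hᵤ s s = 1
  /-- `G(·, s)` solves the homogeneous equation. -/
  equation : ∀ s ∈ Ioo 0 b,
    ∀ᵐ t ∂(volume.restrict (Icc 0 b)), diffOp m b a (fun r => G r s) t = 0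
  /-- `G(·, s)` satisfies the boundary conditions. -/
  boundary : ∀ s ∈ Ioo 0 b, BC (fun r => G r s)

end EvenOrderBVP

end

namespace EvenOrderBVP

/-! The Neumann solution is extended evenly and the Dirichlet solution oddly about `T`. The
vanishing derivatives at `T` make both extensions of class W^{2n,1} on [0, 2T], those at `0` make
them periodic, and the parities of the coefficients make them solve the extended equation
(`IsJet.reflect`). A combination c₁u_N + c₂u_D thus extends to a periodic solution whose right-hand
side is c₁σ₁ + c₂σ₂ on the left half and the mirror image of c₁σ₁ - c₂σ₂ on the right half. If both
have the same sign as `G`, Green's formula makes the combination nonnegative (`nonneg_combination`);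
the three claims are choices of c₁, c₂.

Green's formula itself (`eq_integral_green`) is derived from the defining properties of `G`: ∫
G(t,s) f(s) ds is a periodic solution, and nonresonance identifies it with the given one.
Derivatives are handled in integrated form, as jets of primitives, so Fubini replaces
differentiation under the integral and the jump of `G` produces the term f(t). -/

/-- `F` is a primitive on `[0, b]` of the integrable function `f`. -/
def IsPrimitive (b : ℝ) (F f : ℝ → ℝ) : Prop :=
  IntervalIntegrable f volume 0 b ∧ ∀ t ∈ Icc 0 b, F t = F 0 + ∫ r in (0 : ℝ)..t, f r

/-- `d k`, `k ≤ m`, are the successive derivatives of the absolutely continuous functions `d k`,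
`k < m`, and `d 0` solves `u^(m) + a_{m-1} u^(m-1) + ⋯ + a_0 u = σ` on `[0, b]`. -/
def IsJet (m : ℕ) (b : ℝ) (a : ℕ → ℝ → ℝ) (σ : ℝ → ℝ) (d : ℕ → ℝ → ℝ) : Prop :=
  (∀ k < m, IsPrimitive b (d k) (d (k + 1))) ∧
    ∀ᵐ t ∂(volume.restrict (Icc 0 b)), d m t + ∑ k ∈ Finset.range m, a k t * d k t = σ t

/-! ### Primitives of integrable functions -/

namespace IsPrimitive

variable {b : ℝ} {F f F' f' : ℝ → ℝ}

theorem intervalIntegrable (h : IsPrimitive b F f) {s t : ℝ} (hs : s ∈ Icc 0 b)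
    (ht : t ∈ Icc 0 b) : IntervalIntegrable f volume s t := by
  have hb : (0 : ℝ) ≤ b := hs.1.trans hs.2
  refine h.1.mono_set ?_
  rw [uIcc_of_le hb]
  exact uIcc_subset_Icc hs ht

theorem add (h : IsPrimitive b F f) (h' : IsPrimitive b F' f') :
    IsPrimitive b (fun t => F t + F' t) (fun t => f t + f' t) := by
  refine ⟨h.1.add h'.1, fun t ht => ?_⟩
  have h0 : (0 : ℝ) ∈ Icc 0 b := ⟨le_rfl, ht.1.trans ht.2⟩
  rw [intervalIntegral.integral_add (h.intervalIntegrable h0 ht) (h'.intervalIntegrable h0 ht)]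
  linarith [h.2 t ht, h'.2 t ht]

theorem const_mul (h : IsPrimitive b F f) (c : ℝ) :
    IsPrimitive b (fun t => c * F t) (fun t => c * f t) := by
  refine ⟨h.1.const_mul c, fun t ht => ?_⟩
  rw [intervalIntegral.integral_const_mul]
  linear_combination c * h.2 t ht

theorem absolutelyContinuousOnInterval (hb : 0 ≤ b) (h : IsPrimitive b F f) :
    AbsolutelyContinuousOnInterval F 0 b := by
  have h1 := h.1.absolutelyContinuousOnInterval_intervalIntegral (c := 0) (by simp)
  rw [absolutelyContinuousOnInterval_iff] at h1 ⊢
  intro ε hε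
  obtain ⟨δ, hδ, H⟩ := h1 ε hε
  refine ⟨δ, hδ, fun E hE hE' => ?_⟩
  convert H E hE hE' using 2 with i hi
  have hi' := hE.1 i hi
  rw [uIcc_of_le hb] at hi'
  rw [h.2 _ hi'.1, h.2 _ hi'.2]
  simp

theorem continuousOn (hb : 0 ≤ b) (h : IsPrimitive b F f) : ContinuousOn F (Icc 0 b) := by
  simpa [uIcc_of_le hb] using (h.absolutelyContinuousOnInterval hb).continuousOn

theorem hasDerivWithinAt (h : IsPrimitive b F f) (hf : ContinuousOn f (Icc 0 b)) {t : ℝ}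
    (ht : t ∈ Icc 0 b) : HasDerivWithinAt F (f t) (Icc 0 b) t := by
  have h0 : (0 : ℝ) ∈ Icc 0 b := ⟨le_rfl, ht.1.trans ht.2⟩
  -- Provides the instance that makes the fundamental theorem one-sided at the end points.
  have := Fact.mk ht
  refine HasDerivWithinAt.congr (f := fun x => F 0 + ∫ r in (0 : ℝ)..x, f r) ?_ h.2 (h.2 t ht)
  refine HasDerivWithinAt.const_add _ ?_
  exact intervalIntegral.integral_hasDerivWithinAt_right (h.intervalIntegrable h0 ht)
    (hf.stronglyMeasurableAtFilter_nhdsWithin measurableSet_Icc t) (hf.continuousWithinAt ht)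

theorem ae_hasDerivAt (hb : 0 ≤ b) (h : IsPrimitive b F f) :
    ∀ᵐ t, t ∈ Ioo 0 b → HasDerivAt F (f t) t := by
  filter_upwards [h.1.ae_hasDerivAt_integral] with t ht htb
  rw [uIcc_of_le hb] at ht
  have h1 := (ht (Ioo_subset_Icc_self htb) 0 ⟨le_rfl, hb⟩).const_add (F 0)
  refine h1.congr_of_eventuallyEq ?_
  filter_upwards [Icc_mem_nhds htb.1 htb.2] with x hx using h.2 x hx

/-- The exceptional set serves the derivative of order `p` of `G(·, s)`, which is continuous but has
a corner at `s`. -/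
theorem of_continuousOn {s : Set ℝ} (hs : s.Countable) (hF : ContinuousOn F (Icc 0 b))
    (hd : ∀ t ∈ Icc 0 b, t ∉ s → HasDerivWithinAt F (f t) (Icc 0 b) t)
    (hf : IntervalIntegrable f volume 0 b) : IsPrimitive b F f := by
  refine ⟨hf, fun t ht => ?_⟩
  rw [MeasureTheory.integral_eq_of_hasDerivAt_off_countable F f hs]
  · ring
  · rw [uIcc_of_le ht.1]
    exact hF.mono (Icc_subset_Icc_right ht.2)
  · rintro x ⟨hx, hxs⟩
    rw [min_eq_left ht.1, max_eq_right ht.1] at hx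
    have hx' : x ∈ Ioo 0 b := ⟨hx.1, hx.2.trans_le ht.2⟩
    exact (hd x (Ioo_subset_Icc_self hx') hxs).hasDerivAt (Icc_mem_nhds hx'.1 hx'.2)
  · refine hf.mono_set ?_
    rw [uIcc_of_le ht.1, uIcc_of_le (ht.1.trans ht.2)]
    exact Icc_subset_Icc_right ht.2

theorem of_absolutelyContinuousOnInterval (hF : AbsolutelyContinuousOnInterval F 0 b) :
    IsPrimitive b F (deriv F) := by
  refine ⟨hF.intervalIntegrable_deriv, fun t ht => ?_⟩
  rw [(hF.mono _).integral_deriv_eq_sub]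
  · ring
  · rw [uIcc_of_le ht.1, uIcc_of_le (ht.1.trans ht.2)]
    exact Icc_subset_Icc_right ht.2

theorem congr_ae (hb : 0 ≤ b) (h : IsPrimitive b F f) (hf : ∀ᵐ t, t ∈ Ioo 0 b → f t = f' t) :
    IsPrimitive b F f' := by
  have hne : ∀ᵐ t : ℝ, t ≠ b := by simp [ae_iff, measure_singleton]
  refine ⟨?_, fun t ht => ?_⟩
  · refine h.1.congr_ae ?_
    rw [Filter.EventuallyEq, ae_restrict_iff' measurableSet_uIoc, uIoc_of_le hb]
    filter_upwards [hf, hne] with t ht htb ht'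
    exact ht ⟨ht'.1, lt_of_le_of_ne ht'.2 htb⟩
  · rw [h.2 t ht]
    congr 1
    refine intervalIntegral.integral_congr_ae ?_
    filter_upwards [hf, hne] with r hr hrb hr'
    rw [uIoc_of_le ht.1] at hr'
    exact hr ⟨hr'.1, lt_of_le_of_ne (hr'.2.trans ht.2) hrb⟩

end IsPrimitive

/-! ### Jets and solutions -/

variable {m : ℕ} {b : ℝ} {a : ℕ → ℝ → ℝ} {σ σ' : ℝ → ℝ} {d d' : ℕ → ℝ → ℝ}

theorem IsJet.add (h : IsJet m b a σ d) (h' : IsJet m b a σ' d') :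
    IsJet m b a (fun t => σ t + σ' t) (fun k t => d k t + d' k t) := by
  refine ⟨fun k hk => (h.1 k hk).add (h'.1 k hk), ?_⟩
  filter_upwards [h.2, h'.2] with t ht ht'
  rw [← ht, ← ht']
  simp only [mul_add, Finset.sum_add_distrib]
  ring

theorem IsJet.const_mul (h : IsJet m b a σ d) (c : ℝ) :
    IsJet m b a (fun t => c * σ t) (fun k t => c * d k t) := by
  refine ⟨fun k hk => (h.1 k hk).const_mul c, ?_⟩
  filter_upwards [h.2] with t ht
  rw [← ht, mul_add, Finset.mul_sum]
  congr 1
  exact Finset.sum_congr rfl fun k _ => by ring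

theorem ae_restrict_Icc_iff_Ioo {b : ℝ} {P : ℝ → Prop} :
    (∀ᵐ t ∂(volume.restrict (Icc 0 b)), P t) ↔ ∀ᵐ t, t ∈ Ioo 0 b → P t := by
  rw [← restrict_Ioo_eq_restrict_Icc, ae_restrict_iff' measurableSet_Ioo]

theorem der_succ_eq_deriv {u : ℝ → ℝ} {k : ℕ} {t : ℝ} (ht : t ∈ Ioo 0 b) :
    der b (k + 1) u t = deriv (der b k u) t := by
  have : der b k u = iteratedDerivWithin k u (Icc 0 b) := rfl
  rw [der, iteratedDerivWithin_succ, this, derivWithin_of_mem_nhds (Icc_mem_nhds ht.1 ht.2)]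

theorem der_eq_of_hasDerivWithinAt (hb : 0 < b) {u : ℝ → ℝ} {k : ℕ} {t y : ℝ}
    (ht : t ∈ Icc 0 b) (h : HasDerivWithinAt (der b k u) y (Icc 0 b) t) :
    der b (k + 1) u t = y := by
  rw [der, iteratedDerivWithin_succ]
  exact h.derivWithin (uniqueDiffOn_Icc hb t ht)

theorem isPrimitive_der (hb : 0 < b) {u : ℝ → ℝ} {p k : ℕ}
    (hu : ContDiffOn ℝ ((p : ℕ) : ℕ∞) u (Icc 0 b)) (hk : k < p) :
    IsPrimitive b (der b k u) (der b (k + 1) u) := by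
  have hU := uniqueDiffOn_Icc hb
  rw [contDiffOn_iff_continuousOn_differentiableOn_deriv hU] at hu
  refine IsPrimitive.of_continuousOn countable_empty (hu.1 k (by exact_mod_cast hk.le)) ?_ ?_
  · intro t ht _
    have h1 := (hu.2 k (by exact_mod_cast hk) t ht).hasDerivWithinAt
    rw [der, iteratedDerivWithin_succ]
    exact h1
  · exact ContinuousOn.intervalIntegrable_of_Icc hb.le (hu.1 (k + 1) (by exact_mod_cast hk))

/-- The derivatives of a solution form a jet. -/
theorem IsSolution.isJet (hb : 0 < b) {p : ℕ} {BC : (ℝ → ℝ) → Prop} {u : ℝ → ℝ}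
    (h : IsSolution (p + 1) b a BC σ u) :
    IsJet (p + 1) b a σ (fun k => der b k u) := by
  obtain ⟨⟨hC, hA⟩, -, hE⟩ := h
  simp only [Nat.add_sub_cancel] at hC hA
  refine ⟨fun k hk => ?_, hE⟩
  rcases Nat.lt_succ_iff_lt_or_eq.1 hk with hk | rfl
  · exact isPrimitive_der hb hC hk
  · refine (IsPrimitive.of_absolutelyContinuousOnInterval hA).congr_ae hb.le ?_
    exact Filter.Eventually.of_forall fun t ht => (der_succ_eq_deriv ht).symm

/-- Each differentiation needs a continuous next entry. The top entry is merely integrable, so the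
pointwise identity stops at order `p`. -/
theorem IsJet.der_eq (hb : 0 < b) {p : ℕ} (h : IsJet (p + 1) b a σ d) {k : ℕ} (hk : k ≤ p) :
    ∀ t ∈ Icc 0 b, der b k (d 0) t = d k t := by
  induction k with
  | zero => intro t _; simp [der]
  | succ k ih =>
    intro t ht
    have h1 := (h.1 k (by omega)).hasDerivWithinAt ((h.1 (k + 1) (by omega)).continuousOn hb.le) ht
    exact der_eq_of_hasDerivWithinAt hb ht
      (h1.congr (ih (by omega)) (ih (by omega) t ht))

/-- The first entry of a jet is a solution. -/
theorem IsJet.isSolution (hb : 0 < b) {p : ℕ} (h : IsJet (p + 1) b a σ d)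
    {BC : (ℝ → ℝ) → Prop} (hBC : BC (d 0)) : IsSolution (p + 1) b a BC σ (d 0) := by
  have hU := uniqueDiffOn_Icc hb
  have hcont : ∀ k ≤ p, ContinuousOn (d k) (Icc 0 b) := fun k hk =>
    (h.1 k (by omega)).continuousOn hb.le
  refine ⟨⟨?_, ?_⟩, hBC, ?_⟩
  · simp only [Nat.add_sub_cancel]
    rw [contDiffOn_iff_continuousOn_differentiableOn_deriv hU]
    refine ⟨fun k hk => ?_, fun k hk => ?_⟩
    · have hk' : k ≤ p := by exact_mod_cast hk
      exact (hcont k hk').congr (h.der_eq hb hk')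
    · have hk' : k < p := by exact_mod_cast hk
      exact DifferentiableOn.congr (fun t ht => ((h.1 k (by omega)).hasDerivWithinAt
        (hcont (k + 1) hk') ht).differentiableWithinAt) (h.der_eq hb hk'.le)
  · refine IsPrimitive.absolutelyContinuousOnInterval (f := d (p + 1)) hb.le ?_
    refine ⟨(h.1 p (by omega)).1, fun t ht => ?_⟩
    simp only [Nat.add_sub_cancel]
    rw [h.der_eq hb le_rfl t ht, h.der_eq hb le_rfl 0 ⟨le_rfl, hb.le⟩]
    exact (h.1 p (by omega)).2 t ht
  · have h1 : ∀ᵐ t ∂(volume.restrict (Icc 0 b)), der b (p + 1) (d 0) t = d (p + 1) t := by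
      refine ae_restrict_Icc_iff_Ioo.2 ?_
      filter_upwards [(h.1 p (by omega)).ae_hasDerivAt hb.le] with t ht htb
      rw [der_succ_eq_deriv htb, ← (ht htb).deriv]
      refine Filter.EventuallyEq.deriv_eq ?_
      filter_upwards [Icc_mem_nhds htb.1 htb.2] with x hx using h.der_eq hb le_rfl x hx
    filter_upwards [h.2, h1, ae_restrict_mem measurableSet_Icc] with t ht ht1 htb
    rw [diffOp, ht1, ← ht]
    congr 1
    refine Finset.sum_congr rfl fun k hk => ?_
    rw [h.der_eq hb (Nat.lt_succ_iff.1 (Finset.mem_range.1 hk)) t htb]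

/-! ### Reflection about `T` -/

/-- The extension of `F` from `[0, T]` to `[0, 2T]` by `c * F (2T - t)`. -/
noncomputable def reflect (T c : ℝ) (F : ℝ → ℝ) (t : ℝ) : ℝ :=
  if t ≤ T then F t else c * F (2 * T - t)

theorem reflect_of_le {T c t : ℝ} {F : ℝ → ℝ} (h : t ≤ T) : reflect T c F t = F t := if_pos h

theorem reflect_of_lt {T c t : ℝ} {F : ℝ → ℝ} (h : T < t) :
    reflect T c F t = c * F (2 * T - t) := if_neg h.not_ge

theorem intervalIntegrable_comp_two_mul_sub {T t : ℝ} {f : ℝ → ℝ}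
    (hf : IntervalIntegrable f volume (2 * T - t) T) :
    IntervalIntegrable (fun r => f (2 * T - r)) volume T t := by
  have h := (hf.comp_sub_left (2 * T)).symm
  have e : 2 * T - T = T := by ring
  rwa [e, sub_sub_cancel] at h

theorem intervalIntegrable_reflect {T c : ℝ} {f : ℝ → ℝ} (hT : 0 ≤ T)
    (hf : IntervalIntegrable f volume 0 T) :
    IntervalIntegrable (reflect T c f) volume 0 (2 * T) := by
  refine IntervalIntegrable.trans (b := T) (hf.congr ?_) (IntervalIntegrable.congr
    (f := fun r => c * f (2 * T - r)) ?_ ?_)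
  · intro t ht
    rw [uIoc_of_le hT] at ht
    exact (reflect_of_le ht.2).symm
  · intro t ht
    rw [uIoc_of_le (by linarith)] at ht
    exact (reflect_of_lt ht.1).symm
  · exact (intervalIntegrable_comp_two_mul_sub (by simpa using hf)).const_mul c

/-- The condition `c * F T = F T` is continuity of the extension at `T`: vacuous for `c = 1`, and `F
T = 0` for `c = -1`. The chain rule flips the sign of `c`. -/
theorem IsPrimitive.reflect {T c : ℝ} {F f : ℝ → ℝ} (hT : 0 ≤ T) (h : IsPrimitive T F f)
    (hc : c * F T = F T) :
    IsPrimitive (2 * T) (reflect T c F) (reflect T (-c) f) := by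
  refine ⟨intervalIntegrable_reflect hT h.1, fun t ht => ?_⟩
  have hT' : T ∈ Icc 0 T := ⟨hT, le_rfl⟩
  rw [reflect_of_le hT]
  have key : ∀ s ∈ Icc 0 T, ∫ r in (0 : ℝ)..s, EvenOrderBVP.reflect T (-c) f r
      = ∫ r in (0 : ℝ)..s, f r := fun s hs => by
    refine intervalIntegral.integral_congr fun r hr => ?_
    rw [uIcc_of_le hs.1] at hr
    exact reflect_of_le (hr.2.trans hs.2)
  rcases le_or_gt t T with htT | htT
  · rw [reflect_of_le htT, key t ⟨ht.1, htT⟩, h.2 t ⟨ht.1, htT⟩]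
  · have hs : 2 * T - t ∈ Icc 0 T := ⟨by linarith [ht.2], by linarith⟩
    have hI := intervalIntegrable_reflect (c := -c) hT h.1
    have hsub : ∀ x ∈ Icc 0 (2 * T), ∀ y ∈ Icc 0 (2 * T),
        IntervalIntegrable (EvenOrderBVP.reflect T (-c) f) volume x y := fun x hx y hy => by
      refine hI.mono_set ?_
      rw [uIcc_of_le (by linarith : (0 : ℝ) ≤ 2 * T)]
      exact uIcc_subset_Icc hx hy
    have h0m : (0 : ℝ) ∈ Icc 0 (2 * T) := ⟨le_rfl, by linarith⟩
    have hTm : T ∈ Icc 0 (2 * T) := ⟨hT, by linarith⟩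
    rw [reflect_of_lt htT, ← intervalIntegral.integral_add_adjacent_intervals
      (hsub 0 h0m T hTm) (hsub T hTm t ht), key T hT']
    have h2 : ∫ r in T..t, EvenOrderBVP.reflect T (-c) f r = -c * ∫ r in (2 * T - t)..T, f r := by
      rw [intervalIntegral.integral_congr_ae (g := fun r => -c * f (2 * T - r)),
        intervalIntegral.integral_const_mul, intervalIntegral.integral_comp_sub_left]
      · ring_nf
      · refine Filter.Eventually.of_forall fun r hr => ?_
        rw [uIoc_of_le htT.le] at hr
        exact reflect_of_lt hr.1
    have h3 := intervalIntegral.integral_add_adjacent_intervals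
      (h.intervalIntegrable ⟨le_rfl, hT⟩ hs) (h.intervalIntegrable hs hT')
    rw [h2]
    -- This is c F(2T - t) = c F(T) - c ∫ f over [2T - t, T], with c F(T) replaced by F(T).
    linear_combination c * h.2 _ hs - c * h.2 T hT' + hc + h.2 T hT' + c * h3

/-- The map t ↦ 2T - t preserves Lebesgue measure, hence null sets. -/
theorem ae_restrict_reflect {T : ℝ} {P : ℝ → Prop}
    (h : ∀ᵐ t ∂(volume.restrict (Icc 0 T)), P t) :
    ∀ᵐ t ∂(volume.restrict (Icc 0 (2 * T))), (t ≤ T → P t) ∧ (T < t → P (2 * T - t)) := by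
  rw [ae_restrict_iff' measurableSet_Icc] at h ⊢
  have h' := (volume.measurePreserving_sub_left (2 * T)).quasiMeasurePreserving.ae h
  filter_upwards [h, h'] with t h1 h2 ht
  exact ⟨fun h3 => h1 ⟨ht.1, h3⟩, fun h3 => h2 ⟨by linarith [ht.2], by linarith⟩⟩

theorem extendCoeff_eq_reflect (T : ℝ) (a : ℕ → ℝ → ℝ) (k : ℕ) :
    extendCoeff T a k = reflect T ((-1) ^ k) (a k) := rfl

theorem integrableOn_Icc_iff_intervalIntegrable {b : ℝ} (hb : 0 ≤ b) {f : ℝ → ℝ} :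
    IntegrableOn f (Icc 0 b) ↔ IntervalIntegrable f volume 0 b := by
  rw [intervalIntegrable_iff_integrableOn_Icc_of_le hb]

theorem integrableOn_reflect {T c : ℝ} {f : ℝ → ℝ} (hT : 0 ≤ T) (hf : IntegrableOn f (Icc 0 T)) :
    IntegrableOn (reflect T c f) (Icc 0 (2 * T)) := by
  rw [integrableOn_Icc_iff_intervalIntegrable hT] at hf
  rw [integrableOn_Icc_iff_intervalIntegrable (by linarith)]
  exact intervalIntegrable_reflect hT hf

/-- The even (`ε = 1`) or odd (`ε = -1`) extension of a jet. -/
theorem IsJet.reflect {m : ℕ} {T ε : ℝ} {a : ℕ → ℝ → ℝ} {σ : ℝ → ℝ} {d : ℕ → ℝ → ℝ}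
    (hT : 0 ≤ T) (hm : Even m) (h : IsJet m T a σ d)
    (hε : ∀ k < m, ε * (-1) ^ k * d k T = d k T) :
    IsJet m (2 * T) (extendCoeff T a) (reflect T ε σ)
      (fun k => reflect T (ε * (-1) ^ k) (d k)) := by
  refine ⟨fun k hk => ?_, ?_⟩
  · have h1 := (h.1 k hk).reflect hT (hε k hk)
    have e : ε * (-1) ^ (k + 1) = -(ε * (-1) ^ k) := by ring
    simpa only [e] using h1
  · filter_upwards [ae_restrict_reflect h.2] with t ht
    rcases le_or_gt t T with htT | htT
    · simp only [extendCoeff_eq_reflect, reflect_of_le htT]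
      exact ht.1 htT
    · simp only [extendCoeff_eq_reflect, reflect_of_lt htT]
      -- The parity signs of `a k` and `d k` cancel, leaving `ε` in every lower-order term. The
      -- leading term has no coefficient to absorb its sign, so `m` must be even.
      rw [← ht.2 htT, hm.neg_one_pow, mul_add, Finset.mul_sum, mul_one]
      congr 1
      refine Finset.sum_congr rfl fun k _ => ?_
      have e : ((-1 : ℝ) ^ k) * (-1) ^ k = 1 := by rw [← mul_pow]; simp
      linear_combination (a k (2 * T - t) * ε * d k (2 * T - t)) * e

/-! ### Integration against kernels -/

/-- Integration of the relation "`K(·, s)` minus `θ` times the unit step at `s` is a primitive of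
`K'(·, s)`" against `f(s) ds`. -/
theorem isPrimitive_integral_kernel {b θ : ℝ} (hb : 0 ≤ b) {K K' : ℝ → ℝ → ℝ} {f : ℝ → ℝ}
    (hf : IntegrableOn f (Icc 0 b)) (hK0 : IntegrableOn (fun s => K 0 s * f s) (Icc 0 b))
    (hK' : Integrable (fun p : ℝ × ℝ => K' p.1 p.2 * f p.2)
      ((volume.restrict (Icc 0 b)).prod (volume.restrict (Icc 0 b))))
    (h : ∀ s ∈ Ioo 0 b, ∀ t ∈ Icc 0 b, t ≠ s →
      K t s = K 0 s + θ * (if s < t then 1 else 0) + ∫ r in (0 : ℝ)..t, K' r s) :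
    IsPrimitive b (fun t => ∫ s in Icc 0 b, K t s * f s)
      (fun r => θ * f r + ∫ s in Icc 0 b, K' r s * f s) := by
  have hint : IntegrableOn (fun r => ∫ s in Icc 0 b, K' r s * f s) (Icc 0 b) :=
    hK'.integral_prod_left
  have hsub : ∀ {g : ℝ → ℝ}, IntegrableOn g (Icc 0 b) → ∀ t ∈ Icc 0 b,
      IntervalIntegrable g volume 0 t := fun {g} hg t ht => by
    rw [intervalIntegrable_iff_integrableOn_Icc_of_le ht.1]
    exact hg.mono_set (Icc_subset_Icc_right ht.2)
  refine ⟨((hsub hf b ⟨hb, le_rfl⟩).const_mul θ).add (hsub hint b ⟨hb, le_rfl⟩), fun t ht => ?_⟩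
  rw [intervalIntegral.integral_add ((hsub hf t ht).const_mul θ) (hsub hint t ht),
    intervalIntegral.integral_const_mul]
  have hle : volume.restrict (Ioc 0 t) ≤ volume.restrict (Icc 0 b) :=
    Measure.restrict_mono (Ioc_subset_Icc_self.trans (Icc_subset_Icc_right ht.2)) le_rfl
  have hKt : Integrable (fun p : ℝ × ℝ => K' p.1 p.2 * f p.2)
      ((volume.restrict (Ioc 0 t)).prod (volume.restrict (Icc 0 b))) :=
    hK'.mono_measure (Measure.prod_mono hle le_rfl)
  have hswap : ∫ r in (0 : ℝ)..t, ∫ s in Icc 0 b, K' r s * f s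
      = ∫ s in Icc 0 b, (∫ r in (0 : ℝ)..t, K' r s) * f s := by
    rw [intervalIntegral.integral_of_le ht.1, integral_integral_swap hKt]
    refine integral_congr_ae (Filter.Eventually.of_forall fun s => ?_)
    simp only
    rw [integral_mul_const, intervalIntegral.integral_of_le ht.1]
  have hK'' : IntegrableOn (fun s => (∫ r in (0 : ℝ)..t, K' r s) * f s) (Icc 0 b) := by
    refine hKt.integral_prod_right.congr (Filter.Eventually.of_forall fun s => ?_)
    simp only
    rw [integral_mul_const, intervalIntegral.integral_of_le ht.1]
  have hstep : ∀ s, (if s < t then (1 : ℝ) else 0) * f s = (Iio t).indicator f s := fun s => by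
    by_cases hs : s < t <;> simp [hs]
  have hI : ∫ s in Icc 0 b, (if s < t then (1 : ℝ) else 0) * f s = ∫ r in (0 : ℝ)..t, f r := by
    simp only [hstep]
    rw [setIntegral_indicator measurableSet_Iio, intervalIntegral.integral_of_le ht.1,
      ← integral_Icc_eq_integral_Ioc, integral_Icc_eq_integral_Ico]
    congr 2
    ext s
    simp only [mem_inter_iff, mem_Icc, mem_Iio, mem_Ico]
    exact ⟨fun h => ⟨h.1.1, h.2⟩, fun h => ⟨⟨h.1, (h.2.le.trans ht.2)⟩, h.2⟩⟩
  have hII : IntegrableOn (fun s => (if s < t then (1 : ℝ) else 0) * f s) (Icc 0 b) := by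
    simp only [hstep]
    exact hf.indicator measurableSet_Iio
  have hne : ∀ᵐ s : ℝ, s ≠ t := by simp [ae_iff, measure_singleton]
  have hKts : ∫ s in Icc 0 b, K t s * f s = ∫ s in Icc 0 b,
      ((K 0 s * f s + θ * ((if s < t then (1 : ℝ) else 0) * f s))
        + (∫ r in (0 : ℝ)..t, K' r s) * f s) := by
    -- For fixed `t`, the relation `h` is missing only at `s = t` and at the end points, a null set.
    refine integral_congr_ae (ae_restrict_Icc_iff_Ioo.2 ?_)
    filter_upwards [hne] with s hs hsb
    rw [h s hsb t ht hs.symm]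
    ring
  simp only
  have hKII : IntegrableOn
      (fun s => K 0 s * f s + θ * ((if s < t then (1 : ℝ) else 0) * f s)) (Icc 0 b) :=
    hK0.add (hII.const_mul θ)
  rw [hKts, integral_add hKII hK'', integral_add hK0 (hII.const_mul θ),
    integral_const_mul, hI, hswap]
  ring

/-- A kernel that is bounded and measurable on `[0, b] × [0, b]`. -/
def IsBddKernel (b : ℝ) (g : ℝ → ℝ → ℝ) : Prop :=
  AEStronglyMeasurable (fun p : ℝ × ℝ => g p.1 p.2)
      ((volume.restrict (Icc 0 b)).prod (volume.restrict (Icc 0 b))) ∧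
    ∃ M : ℝ, ∀ t ∈ Icc 0 b, ∀ s ∈ Icc 0 b, |g t s| ≤ M

/-- `φ` and `f` depend on different variables, so their product is integrable on the square although
each is only L¹. Here `φ` will be a coefficient or the constant `1`. -/
theorem IsBddKernel.integrable_mul {b : ℝ} {g : ℝ → ℝ → ℝ} (hg : IsBddKernel b g) {φ f : ℝ → ℝ}
    (hφ : IntegrableOn φ (Icc 0 b)) (hf : IntegrableOn f (Icc 0 b)) :
    Integrable (fun p : ℝ × ℝ => φ p.1 * g p.1 p.2 * f p.2)
      ((volume.restrict (Icc 0 b)).prod (volume.restrict (Icc 0 b))) := by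
  obtain ⟨hm, M, hM⟩ := hg
  have h1 := (hφ.mul_prod hf).bdd_mul (c := M) hm ?_
  · refine h1.congr (Filter.Eventually.of_forall fun p => ?_)
    simp only
    ring
  · rw [Measure.prod_restrict]
    filter_upwards [ae_restrict_mem (measurableSet_Icc.prod measurableSet_Icc)] with p hp
    exact hM _ hp.1 _ hp.2

theorem isBddKernel_of_continuousOn {b : ℝ} {g : ℝ → ℝ → ℝ}
    (hg : ContinuousOn (fun p : ℝ × ℝ => g p.1 p.2) (Icc 0 b ×ˢ Icc 0 b)) : IsBddKernel b g := by
  refine ⟨?_, ?_⟩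
  · rw [Measure.prod_restrict]
    exact hg.aestronglyMeasurable (measurableSet_Icc.prod measurableSet_Icc)
  · obtain ⟨M, hM⟩ := (isCompact_Icc.prod isCompact_Icc).exists_bound_of_continuousOn hg
    exact ⟨M, fun t ht s hs => hM (t, s) ⟨ht, hs⟩⟩

/-- The kernel equal to `Hₗ` for `s < t` and to `Hᵤ` for `t ≤ s`. -/
noncomputable def glue (Hl Hu : ℝ → ℝ → ℝ) (t s : ℝ) : ℝ := if s < t then Hl t s else Hu t s

/-- Both closed triangles are compact, so each branch is bounded and measurable up to the diagonal.
-/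
theorem isBddKernel_glue {b : ℝ} {Hl Hu : ℝ → ℝ → ℝ}
    (hl : ContinuousOn (fun p : ℝ × ℝ => Hl p.1 p.2) {p | 0 ≤ p.2 ∧ p.2 ≤ p.1 ∧ p.1 ≤ b})
    (hu : ContinuousOn (fun p : ℝ × ℝ => Hu p.1 p.2) {p | 0 ≤ p.1 ∧ p.1 ≤ p.2 ∧ p.2 ≤ b}) :
    IsBddKernel b (glue Hl Hu) := by
  have cl : IsClosed {p : ℝ × ℝ | 0 ≤ p.2 ∧ p.2 ≤ p.1 ∧ p.1 ≤ b} :=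
    (isClosed_le continuous_const continuous_snd).inter
      ((isClosed_le continuous_snd continuous_fst).inter
        (isClosed_le continuous_fst continuous_const))
  have cu : IsClosed {p : ℝ × ℝ | 0 ≤ p.1 ∧ p.1 ≤ p.2 ∧ p.2 ≤ b} :=
    (isClosed_le continuous_const continuous_fst).inter
      ((isClosed_le continuous_fst continuous_snd).inter
        (isClosed_le continuous_snd continuous_const))
  have hS : MeasurableSet {p : ℝ × ℝ | p.2 < p.1} :=
    (isOpen_lt (by fun_prop) (by fun_prop)).measurableSet
  refine ⟨?_, ?_⟩
  · have h := AEStronglyMeasurable.piecewise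
      (μ := (volume.restrict (Icc (0 : ℝ) b)).prod (volume.restrict (Icc 0 b))) hS
      (f := fun p : ℝ × ℝ => Hl p.1 p.2) (g := fun p : ℝ × ℝ => Hu p.1 p.2) ?_ ?_
    · exact h
    · rw [Measure.prod_restrict, Measure.restrict_restrict hS]
      refine (hl.aestronglyMeasurable cl.measurableSet).mono_measure
        (Measure.restrict_mono ?_ le_rfl)
      rintro p ⟨hp, hp1, hp2⟩
      exact ⟨hp2.1, le_of_lt hp, hp1.2⟩
    · rw [Measure.prod_restrict, Measure.restrict_restrict hS.compl]
      refine (hu.aestronglyMeasurable cu.measurableSet).mono_measure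
        (Measure.restrict_mono ?_ le_rfl)
      rintro p ⟨hp, hp1, hp2⟩
      exact ⟨hp1.1, not_lt.1 hp, hp2.2⟩
  · have kl : IsCompact {p : ℝ × ℝ | 0 ≤ p.2 ∧ p.2 ≤ p.1 ∧ p.1 ≤ b} :=
      (isCompact_Icc.prod isCompact_Icc : IsCompact (Icc (0 : ℝ) b ×ˢ Icc (0 : ℝ) b)).of_isClosed_subset
        cl fun p hp => ⟨⟨hp.1.trans hp.2.1, hp.2.2⟩, hp.1, hp.2.1.trans hp.2.2⟩
    have ku : IsCompact {p : ℝ × ℝ | 0 ≤ p.1 ∧ p.1 ≤ p.2 ∧ p.2 ≤ b} :=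
      (isCompact_Icc.prod isCompact_Icc : IsCompact (Icc (0 : ℝ) b ×ˢ Icc (0 : ℝ) b)).of_isClosed_subset
        cu fun p hp => ⟨⟨hp.1, hp.2.1.trans hp.2.2⟩, hp.1.trans hp.2.1, hp.2.2⟩
    obtain ⟨M, hM⟩ := kl.exists_bound_of_continuousOn hl
    obtain ⟨N, hN⟩ := ku.exists_bound_of_continuousOn hu
    refine ⟨max M N, fun t ht s hs => ?_⟩
    rw [glue]
    split_ifs with hst
    · exact (hM (t, s) ⟨hs.1, hst.le, ht.2⟩).trans (le_max_left _ _)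
    · exact (hN (t, s) ⟨ht.1, not_lt.1 hst, hs.2⟩).trans (le_max_right _ _)

/-! ### Green's formula -/

/-- The derivatives `∂ₜ^k G`, `k ≤ p + 1`, the last one being given by `H`. -/
noncomputable def greenDer (p : ℕ) (b : ℝ) (G H : ℝ → ℝ → ℝ) (k : ℕ) (t s : ℝ) : ℝ :=
  if k ≤ p then der b k (fun r => G r s) t else H t s

theorem greenDer_of_le {p k : ℕ} {b t s : ℝ} {G H : ℝ → ℝ → ℝ} (hk : k ≤ p) :
    greenDer p b G H k t s = der b k (fun r => G r s) t := if_pos hk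

theorem greenDer_last {p : ℕ} {b t s : ℝ} {G H : ℝ → ℝ → ℝ} :
    greenDer p b G H (p + 1) t s = H t s := if_neg (by omega)

/-- The properties of a Green's function of order `p + 2`, in integrated form. -/
structure IsGreenJet (p : ℕ) (b : ℝ) (a : ℕ → ℝ → ℝ) (g : ℕ → ℝ → ℝ → ℝ) : Prop where
  bdd : ∀ k ≤ p + 1, IsBddKernel b (g k)
  cont : ∀ k ≤ p + 1, ContinuousOn (g k 0) (Icc 0 b)
  prim : ∀ k ≤ p, ∀ s ∈ Ioo 0 b, IsPrimitive b (fun t => g k t s) (fun t => g (k + 1) t s)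
  -- The factor `1` is the jump, in the role of `θ` in `isPrimitive_integral_kernel`.
  last : ∀ s ∈ Ioo 0 b, ∀ t ∈ Icc 0 b, t ≠ s → g (p + 1) t s = g (p + 1) 0 s +
    1 * (if s < t then 1 else 0) +
      ∫ r in (0 : ℝ)..t, -∑ k ∈ Finset.range (p + 2), a k r * g k r s
  periodic : ∀ k ≤ p + 1, ∀ s ∈ Ioo 0 b, g k 0 s = g k b s

/-- Below order `p + 1` the kernels have no jump (`θ = 0`). At order `p + 1` the unit jump (`θ = 1`)
adds f(t), the right-hand side of the equation. -/
theorem IsGreenJet.isJet {p : ℕ} {b : ℝ} {a : ℕ → ℝ → ℝ} {g : ℕ → ℝ → ℝ → ℝ} {f : ℝ → ℝ}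
    (hb : 0 < b) (hg : IsGreenJet p b a g) (ha : ∀ k < p + 2, IntegrableOn (a k) (Icc 0 b))
    (hf : IntegrableOn f (Icc 0 b)) :
    IsJet (p + 2) b a f (fun k t => if k < p + 2 then ∫ s in Icc 0 b, g k t s * f s else
      f t + ∫ s in Icc 0 b, (-∑ j ∈ Finset.range (p + 2), a j t * g j t s) * f s) := by
  have hprod : ∀ k < p + 2, Integrable (fun q : ℝ × ℝ => a k q.1 * g k q.1 q.2 * f q.2)
      ((volume.restrict (Icc 0 b)).prod (volume.restrict (Icc 0 b))) := fun k hk =>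
    (hg.bdd k (by omega)).integrable_mul (ha k hk) hf
  have hprod' : ∀ k < p + 2, Integrable (fun q : ℝ × ℝ => g k q.1 q.2 * f q.2)
      ((volume.restrict (Icc 0 b)).prod (volume.restrict (Icc 0 b))) := fun k hk => by
    have h1 : IntegrableOn (fun _ : ℝ => (1 : ℝ)) (Icc 0 b) :=
      continuousOn_const.integrableOn_compact isCompact_Icc
    simpa only [one_mul] using (hg.bdd k (by omega)).integrable_mul h1 hf
  -- The line `t = 0` is null in the square, so bounds on the kernel up to null sets would not give
  -- this; continuity along the line does.
  have h0 : ∀ k ≤ p + 1, IntegrableOn (fun s => g k 0 s * f s) (Icc 0 b) := fun k hk =>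
    hf.continuousOn_mul (hg.cont k hk) isCompact_Icc
  refine ⟨fun k hk => ?_, ?_⟩
  · rcases Nat.lt_succ_iff_lt_or_eq.1 hk with hk' | rfl
    · have h := isPrimitive_integral_kernel (θ := 0) (K := g k) (K' := g (k + 1)) hb.le hf
        (h0 k (by omega)) (hprod' (k + 1) (by omega)) ?_
      · simpa [hk, hk'] using h
      · intro s hs t ht _
        linear_combination (hg.prim k (by omega) s hs).2 t ht
    · have h := isPrimitive_integral_kernel (θ := 1) (K := g (p + 1))
        (K' := fun r s => -∑ k ∈ Finset.range (p + 2), a k r * g k r s) hb.le hf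
        (h0 (p + 1) le_rfl) ?_ hg.last
      · simpa using h
      · simp only [neg_mul, Finset.sum_mul]
        exact (integrable_finsetSum _ fun k hk => hprod k (Finset.mem_range.1 hk)).neg
  -- Fubini makes the sections integrable for almost every `t`, which suffices for an equation
  -- holding a.e.
  · have hsec : ∀ᵐ t ∂(volume.restrict (Icc 0 b)), ∀ k ∈ Finset.range (p + 2),
        IntegrableOn (fun s => a k t * g k t s * f s) (Icc 0 b) := by
      rw [Finset.eventually_all]
      exact fun k hk => (hprod k (Finset.mem_range.1 hk)).prod_right_ae
    filter_upwards [hsec] with t ht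
    have h1 : ∫ s in Icc 0 b, (-∑ j ∈ Finset.range (p + 2), a j t * g j t s) * f s
        = -∑ j ∈ Finset.range (p + 2), a j t * ∫ s in Icc 0 b, g j t s * f s := by
      simp only [neg_mul, Finset.sum_mul]
      rw [integral_neg, integral_finsetSum _ ht]
      congr 1
      refine Finset.sum_congr rfl fun k _ => ?_
      rw [← integral_const_mul]
      simp only [mul_assoc]
    have h2 : ∑ k ∈ Finset.range (p + 2), a k t *
        (if k < p + 2 then ∫ s in Icc 0 b, g k t s * f s else
          f t + ∫ s in Icc 0 b, (-∑ j ∈ Finset.range (p + 2), a j t * g j t s) * f s)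
        = ∑ j ∈ Finset.range (p + 2), a j t * ∫ s in Icc 0 b, g j t s * f s :=
      Finset.sum_congr rfl fun k hk => by rw [if_pos (Finset.mem_range.1 hk)]
    rw [h2, if_neg (lt_irrefl _), h1]
    ring

/-- Applied separately on [0, s] and [s, b], since the top derivative of `G(·, s)` is absolutely
continuous only on either side of the jump. -/
theorem integral_eq_sub_of_deriv {x y t : ℝ} {F Φ : ℝ → ℝ}
    (hF : AbsolutelyContinuousOnInterval F x y) (ht : t ∈ Icc x y)
    (hΦ : ∀ᵐ r, r ∈ Ioo x y → deriv F r = Φ r) :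
    IntervalIntegrable Φ volume x t ∧ ∫ r in x..t, Φ r = F t - F x := by
  have hF' : AbsolutelyContinuousOnInterval F x t := hF.mono <| by
    rw [uIcc_of_le ht.1, uIcc_of_le (ht.1.trans ht.2)]
    exact Icc_subset_Icc_right ht.2
  have hne : ∀ᵐ r : ℝ, r ≠ y := by simp [ae_iff, measure_singleton]
  have hae : ∀ᵐ r, r ∈ uIoc x t → deriv F r = Φ r := by
    filter_upwards [hΦ, hne] with r hr hry hrt
    rw [uIoc_of_le ht.1] at hrt
    exact hr ⟨hrt.1, lt_of_le_of_ne (hrt.2.trans ht.2) hry⟩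
  refine ⟨hF'.intervalIntegrable_deriv.congr_ae ?_, ?_⟩
  · rw [Filter.EventuallyEq, ae_restrict_iff' measurableSet_uIoc]
    exact hae
  · rw [← hF'.integral_deriv_eq_sub]
    refine intervalIntegral.integral_congr_ae ?_
    filter_upwards [hae] with r hr hrt using (hr hrt).symm

/-- The derivatives of a periodic Green's function satisfy the relations of `IsGreenJet`. -/
theorem IsGreenFunction.exists_isGreenJet {n p : ℕ} (hp : 2 * n = p + 2) {b : ℝ} (hb : 0 < b)
    {a : ℕ → ℝ → ℝ} {G : ℝ → ℝ → ℝ} (hG : IsGreenFunction (p + 2) b a (PeriodicBC n b) G) :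
    ∃ g : ℕ → ℝ → ℝ → ℝ, g 0 = G ∧ IsGreenJet p b a g := by
  obtain ⟨hC, hcont, ⟨Hl, Hu, hl, hu, dl, du, acl, acu, jmp⟩, heq, hbd⟩ := hG
  simp only [Nat.add_sub_cancel] at hC hcont dl du
  have h0b : (0 : ℝ) ∈ Icc 0 b := ⟨le_rfl, hb.le⟩
  have hbb : b ∈ Icc 0 b := ⟨hb.le, le_rfl⟩
  have glue_lt : ∀ {t s : ℝ}, s < t → glue Hl Hu t s = Hl t s := fun h => if_pos h
  have glue_le : ∀ {t s : ℝ}, t ≤ s → glue Hl Hu t s = Hu t s := fun h => if_neg h.not_gt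
  have hder : ∀ s ∈ Icc 0 b, ∀ t ∈ Icc 0 b, t ≠ s →
      HasDerivWithinAt (der b p (fun r => G r s)) (glue Hl Hu t s) (Icc 0 b) t := by
    intro s hs t ht hts
    rcases lt_or_gt_of_ne hts with h | h
    · rw [glue_le h.le]
      exact du t ht s hs h
    · rw [glue_lt h]
      exact dl t ht s hs h
  have hgd : ∀ s ∈ Ioo 0 b, ∀ t ∈ Icc 0 b, t ≠ s → ∀ k ≤ p + 1,
      greenDer p b G (glue Hl Hu) k t s = der b k (fun r => G r s) t := by
    intro s hs t ht hts k hk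
    rcases Nat.le_succ_iff.1 hk with hk | rfl
    · exact greenDer_of_le hk
    · rw [greenDer_last]
      exact (der_eq_of_hasDerivWithinAt hb ht (hder s (Ioo_subset_Icc_self hs) t ht hts)).symm
  refine ⟨greenDer p b G (glue Hl Hu), ?_, ?_, ?_, ?_, ?_, ?_⟩
  · funext t s
    simp [greenDer_of_le (Nat.zero_le p), der]
  · intro k hk
    rcases Nat.le_succ_iff.1 hk with hk | rfl
    · have e : greenDer p b G (glue Hl Hu) k = fun t s => der b k (fun r => G r s) t :=
        funext₂ fun t s => greenDer_of_le hk
      rw [e]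
      exact isBddKernel_of_continuousOn (hcont k hk)
    · have e : greenDer p b G (glue Hl Hu) (p + 1) = glue Hl Hu :=
        funext₂ fun t s => greenDer_last
      rw [e]
      exact isBddKernel_glue hl hu
  · intro k hk
    have hpair : ContinuousOn (fun s : ℝ => ((0 : ℝ), s)) (Icc 0 b) := by fun_prop
    rcases Nat.le_succ_iff.1 hk with hk | rfl
    · refine ((hcont k hk).comp hpair fun s hs => ⟨h0b, hs⟩).congr fun s _ => ?_
      exact greenDer_of_le hk
    -- `glue` uses `Hu` on the diagonal, so the whole line `t = 0`, including its corner, lies in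
    -- one branch.
    · refine (hu.comp hpair fun s hs => ⟨le_rfl, hs.1, hs.2⟩).congr fun s hs => ?_
      rw [greenDer_last, glue_le hs.1]
      rfl
  · intro k hk s hs
    have hs' := Ioo_subset_Icc_self hs
    have e : (fun t => greenDer p b G (glue Hl Hu) k t s) = der b k (fun r => G r s) :=
      funext fun t => greenDer_of_le hk
    rw [e]
    rcases lt_or_eq_of_le hk with hk | rfl
    · have e' : (fun t => greenDer p b G (glue Hl Hu) (k + 1) t s)
          = der b (k + 1) (fun r => G r s) := funext fun t => greenDer_of_le hk
      rw [e']
      exact isPrimitive_der hb (hC s hs') hk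
    · simp only [greenDer_last]
      refine IsPrimitive.of_continuousOn (countable_singleton s) ?_ (hder s hs') ?_
      · exact (hC s hs').continuousOn_iteratedDerivWithin le_rfl (uniqueDiffOn_Icc hb)
      · refine IntervalIntegrable.trans (b := s) ?_ ?_
        · refine (acu s hs).continuousOn.intervalIntegrable.congr fun t ht => ?_
          rw [uIoc_of_le hs.1.le] at ht
          exact (glue_le ht.2).symm
        · refine (acl s hs).continuousOn.intervalIntegrable.congr fun t ht => ?_
          rw [uIoc_of_le hs.2.le] at ht
          exact (glue_lt ht.1).symm
  · intro s hs t ht hts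
    have hode : ∀ᵐ r, r ∈ Ioo 0 b → r ≠ s → deriv (der b (p + 1) (fun r => G r s)) r
        = -∑ k ∈ Finset.range (p + 2), a k r * greenDer p b G (glue Hl Hu) k r s := by
      filter_upwards [ae_restrict_Icc_iff_Ioo.1 (heq s hs)] with r hr hrb hrs
      have h1 := hr hrb
      rw [diffOp, der_succ_eq_deriv hrb] at h1
      rw [eq_neg_of_add_eq_zero_left h1]
      congr 1
      refine Finset.sum_congr rfl fun k hk => ?_
      rw [hgd s hs r (Ioo_subset_Icc_self hrb) hrs k (Nat.lt_succ_iff.1 (Finset.mem_range.1 hk))]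
    have hU : ∀ᵐ r, r ∈ Ioo 0 s → deriv (fun t => Hu t s) r
        = -∑ k ∈ Finset.range (p + 2), a k r * greenDer p b G (glue Hl Hu) k r s := by
      filter_upwards [hode] with r hr hrs
      rw [← hr ⟨hrs.1, hrs.2.trans hs.2⟩ hrs.2.ne]
      refine Filter.EventuallyEq.deriv_eq ?_
      filter_upwards [Ioo_mem_nhds hrs.1 hrs.2] with x hx
      have hxb : x ∈ Icc 0 b := ⟨hx.1.le, (hx.2.trans hs.2).le⟩
      rw [← hgd s hs x hxb hx.2.ne (p + 1) le_rfl, greenDer_last, glue_le hx.2.le]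
    have hL : ∀ᵐ r, r ∈ Ioo s b → deriv (fun t => Hl t s) r
        = -∑ k ∈ Finset.range (p + 2), a k r * greenDer p b G (glue Hl Hu) k r s := by
      filter_upwards [hode] with r hr hrs
      rw [← hr ⟨hs.1.trans hrs.1, hrs.2⟩ hrs.1.ne']
      refine Filter.EventuallyEq.deriv_eq ?_
      filter_upwards [Ioo_mem_nhds hrs.1 hrs.2] with x hx
      have hxb : x ∈ Icc 0 b := ⟨(hs.1.trans hx.1).le, hx.2.le⟩
      rw [← hgd s hs x hxb hx.1.ne' (p + 1) le_rfl, greenDer_last, glue_lt hx.1]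
    rw [greenDer_last, greenDer_last, glue_le hs.1.le]
    rcases lt_or_gt_of_ne hts with h | h
    · rw [(integral_eq_sub_of_deriv (acu s hs) ⟨ht.1, h.le⟩ hU).2, if_neg h.not_gt, glue_le h.le]
      ring
    · have h1 := integral_eq_sub_of_deriv (acu s hs) ⟨hs.1.le, le_rfl⟩ hU
      have h2 := integral_eq_sub_of_deriv (acl s hs) ⟨h.le, ht.2⟩ hL
      -- The increments of `Hu` on [0, s] and of `Hl` on [s, t] telescope except at `s`, where the
      -- jump supplies the unit step.
      rw [← intervalIntegral.integral_add_adjacent_intervals h1.1 h2.1, h1.2, h2.2, if_pos h,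
        glue_lt h]
      linear_combination jmp s hs
  · intro k hk s hs
    rw [hgd s hs 0 h0b hs.1.ne k hk, hgd s hs b hbb hs.2.ne' k hk]
    exact hbd s hs k (by omega)

/-- Green's formula: a solution of the periodic problem is the integral of the right-hand side
against the Green's function. -/
theorem eq_integral_green {n p : ℕ} (hp : 2 * n = p + 2) {b : ℝ} (hb : 0 < b)
    {a : ℕ → ℝ → ℝ} (ha : ∀ k < p + 2, IntegrableOn (a k) (Icc 0 b))
    (hP : Nonresonant (p + 2) b a (PeriodicBC n b)) {G : ℝ → ℝ → ℝ}
    (hG : IsGreenFunction (p + 2) b a (PeriodicBC n b) G) {f : ℝ → ℝ}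
    (hf : IntegrableOn f (Icc 0 b)) {w : ℕ → ℝ → ℝ} (hw : IsJet (p + 2) b a f w)
    (hper : ∀ k < p + 2, w k 0 = w k b) :
    ∀ t ∈ Icc 0 b, w 0 t = ∫ s in Icc 0 b, G t s * f s := by
  obtain ⟨g, rfl, hg⟩ := hG.exists_isGreenJet hp hb
  have hv := hg.isJet hb ha hf
  -- The difference from the integral solves the homogeneous periodic problem.
  have hd := hw.add (hv.const_mul (-1))
  have hf0 : (fun t => f t + -1 * f t) = fun _ => 0 := funext fun t => by ring
  rw [hf0] at hd
  intro t ht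
  have h0 := hP _ (hd.isSolution hb ?_) t ht
  · simp only [if_pos (Nat.succ_pos (p + 1))] at h0
    linarith
  · intro k hk
    rw [hp] at hk
    have hk' : k ≤ p + 1 := Nat.lt_succ_iff.1 hk
    rw [hd.der_eq hb hk' 0 ⟨le_rfl, hb.le⟩, hd.der_eq hb hk' b ⟨hb.le, le_rfl⟩]
    simp only [if_pos hk]
    rw [hper k hk]
    congr 2
    refine integral_congr_ae (ae_restrict_Icc_iff_Ioo.2 (Filter.Eventually.of_forall fun s hs => ?_))
    simp only
    rw [hg.periodic k hk' s hs]

/-! ### Comparison of the Neumann and Dirichlet solutions -/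

theorem integrableOn_extendCoeff {T : ℝ} (hT : 0 ≤ T) {a : ℕ → ℝ → ℝ} {k : ℕ}
    (h : IntegrableOn (a k) (Icc 0 T)) : IntegrableOn (extendCoeff T a k) (Icc 0 (2 * T)) :=
  integrableOn_reflect hT h

/-- For even `k` the sign is `1`; for odd `k` the boundary value is zero. The value at `b` serves
gluing, the one at `0` periodicity. In the Dirichlet case the parities are exchanged. -/
theorem NeumannBC.sign_der {n : ℕ} {b : ℝ} {u : ℝ → ℝ} (h : NeumannBC n b u) {k : ℕ}
    (hk : k < 2 * n) : 1 * (-1) ^ k * der b k u 0 = der b k u 0 ∧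
      1 * (-1) ^ k * der b k u b = der b k u b := by
  rcases Nat.even_or_odd k with hk' | ⟨j, rfl⟩
  · simp [hk'.neg_one_pow]
  · simp [h j (by omega)]

theorem DirichletBC.sign_der {n : ℕ} {b : ℝ} {u : ℝ → ℝ} (h : DirichletBC n b u) {k : ℕ}
    (hk : k < 2 * n) : -1 * (-1) ^ k * der b k u 0 = der b k u 0 ∧
      -1 * (-1) ^ k * der b k u b = der b k u b := by
  rcases Nat.even_or_odd' k with ⟨j, rfl | rfl⟩
  · simp [h j (by omega)]
  · simp [pow_succ, pow_mul]

theorem reflect_periodic {T c : ℝ} (hT : 0 < T) {F : ℝ → ℝ} (h : c * F 0 = F 0) :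
    reflect T c F 0 = reflect T c F (2 * T) := by
  rw [reflect_of_le hT.le, reflect_of_lt (by linarith), sub_self, h]

/-- Comparison principle: a combination of the Neumann and the Dirichlet solution is nonnegative
if `G` and the right-hand side of the extended periodic problem have the same sign `e`. -/
theorem nonneg_combination {n p : ℕ} (hp : 2 * n = p + 2) {T : ℝ} (hT : 0 < T)
    {a : ℕ → ℝ → ℝ} (ha : ∀ k < p + 2, IntegrableOn (a k) (Icc 0 T))
    (hP : Nonresonant (p + 2) (2 * T) (extendCoeff T a) (PeriodicBC n (2 * T)))
    {G : ℝ → ℝ → ℝ}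
    (hG : IsGreenFunction (p + 2) (2 * T) (extendCoeff T a) (PeriodicBC n (2 * T)) G)
    {σ₁ σ₂ : ℝ → ℝ} (hσ₁ : IntegrableOn σ₁ (Icc 0 T)) (hσ₂ : IntegrableOn σ₂ (Icc 0 T))
    {uN uD : ℝ → ℝ} (huN : IsSolution (p + 2) T a (NeumannBC n T) σ₁ uN)
    (huD : IsSolution (p + 2) T a (DirichletBC n T) σ₂ uD) {e c₁ c₂ : ℝ} (he : e * e = 1)
    (hsign : ∀ t ∈ Icc 0 (2 * T), ∀ s ∈ Icc 0 (2 * T), 0 ≤ e * G t s)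
    (hσ : ∀ᵐ t ∂(volume.restrict (Icc 0 T)),
      0 ≤ e * (c₁ * σ₁ t + c₂ * σ₂ t) ∧ 0 ≤ e * (c₁ * σ₁ t - c₂ * σ₂ t)) :
    ∀ t ∈ Icc 0 T, 0 ≤ c₁ * uN t + c₂ * uD t := by
  have hm : Even (p + 2) := hp ▸ even_two_mul n
  have hb : 0 < 2 * T := by linarith
  have jN := (huN.isJet hT).reflect (ε := 1) hT.le hm
    fun k hk => (huN.2.1.sign_der (hp ▸ hk)).2
  have jD := (huD.isJet hT).reflect (ε := -1) hT.le hm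
    fun k hk => (huD.2.1.sign_der (hp ▸ hk)).2
  have j := (jN.const_mul c₁).add (jD.const_mul c₂)
  have hf := ((integrableOn_reflect (c := 1) hT.le hσ₁).const_mul c₁).add
    ((integrableOn_reflect (c := -1) hT.le hσ₂).const_mul c₂)
  have hrep := eq_integral_green hp hb (fun k hk => integrableOn_extendCoeff hT.le (ha k hk)) hP
    hG hf j fun k hk => by
      rw [reflect_periodic hT (huN.2.1.sign_der (hp ▸ hk)).1,
        reflect_periodic hT (huD.2.1.sign_der (hp ▸ hk)).1]
  intro t ht
  have ht2 : t ∈ Icc 0 (2 * T) := ⟨ht.1, by linarith [ht.2]⟩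
  have h := hrep t ht2
  simp only [reflect_of_le ht.2, der, iteratedDerivWithin_zero] at h
  rw [h]
  refine integral_nonneg_of_ae ?_
  filter_upwards [ae_restrict_reflect hσ, ae_restrict_mem measurableSet_Icc] with s hs hsb
  have hGs := hsign t ht2 s hsb
  have hfs : 0 ≤ e * (c₁ * reflect T 1 σ₁ s + c₂ * reflect T (-1) σ₂ s) := by
    -- The odd extension changes the sign of `σ₂` past `T`; hence the two inequalities in `hσ`.
    rcases le_or_gt s T with hsT | hsT
    · rw [reflect_of_le hsT, reflect_of_le hsT]
      exact (hs.1 hsT).1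
    · rw [reflect_of_lt hsT, reflect_of_lt hsT]
      convert (hs.2 hsT).2 using 1
      ring
  have h1 := mul_nonneg hGs hfs
  have h2 : e * G t s * (e * (c₁ * reflect T 1 σ₁ s + c₂ * reflect T (-1) σ₂ s))
      = G t s * (c₁ * reflect T 1 σ₁ s + c₂ * reflect T (-1) σ₂ s) := by
    linear_combination (G t s * (c₁ * reflect T 1 σ₁ s + c₂ * reflect T (-1) σ₂ s)) * he
  rw [h2] at h1
  exact h1

end EvenOrderBVP

open EvenOrderBVP in
theorem mainTheorem6 (n : ℕ) (hn : 1 ≤ n) (T : ℝ) (hT : 0 < T)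
    (α : ℝ≥0∞) (hα : 1 ≤ α) (a : ℕ → ℝ → ℝ)
    (ha : ∀ k < 2 * n, MemLp (a k) α (volume.restrict (Icc 0 T)))
    (hN : Nonresonant (2 * n) T a (NeumannBC n T))
    (hD : Nonresonant (2 * n) T a (DirichletBC n T))
    (hP : Nonresonant (2 * n) (2 * T) (extendCoeff T a) (PeriodicBC n (2 * T)))
    (G : ℝ → ℝ → ℝ)
    (hG : IsGreenFunction (2 * n) (2 * T) (extendCoeff T a) (PeriodicBC n (2 * T)) G)
    (σ₁ σ₂ : ℝ → ℝ) (hσ₁ : IntegrableOn σ₁ (Icc 0 T)) (hσ₂ : IntegrableOn σ₂ (Icc 0 T))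
    (uN uD : ℝ → ℝ)
    (huN : IsSolution (2 * n) T a (NeumannBC n T) σ₁ uN)
    (huD : IsSolution (2 * n) T a (DirichletBC n T) σ₂ uD) :
    ((∀ t ∈ Icc 0 (2 * T), ∀ s ∈ Icc 0 (2 * T), 0 ≤ G t s) →
      (∀ᵐ t ∂(volume.restrict (Icc 0 T)), |σ₂ t| ≤ σ₁ t) →
      ∀ t ∈ Icc 0 T, |uD t| ≤ uN t) ∧
    ((∀ t ∈ Icc 0 (2 * T), ∀ s ∈ Icc 0 (2 * T), G t s ≤ 0) →
      (∀ᵐ t ∂(volume.restrict (Icc 0 T)), 0 ≤ σ₂ t ∧ σ₂ t ≤ σ₁ t) →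
      ∀ t ∈ Icc 0 T, uN t ≤ 0 ∧ uN t ≤ uD t) ∧
    ((∀ t ∈ Icc 0 (2 * T), ∀ s ∈ Icc 0 (2 * T), G t s ≤ 0) →
      (∀ᵐ t ∂(volume.restrict (Icc 0 T)), σ₁ t ≤ σ₂ t ∧ σ₂ t ≤ 0) →
      ∀ t ∈ Icc 0 T, 0 ≤ uN t ∧ uD t ≤ uN t) := by
  obtain ⟨p, hp⟩ : ∃ p, 2 * n = p + 2 := ⟨2 * n - 2, by omega⟩
  rw [hp] at ha hP hG huN huD
  -- On a bounded interval, L^α with α ≥ 1 embeds in L¹.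
  have ha' : ∀ k < p + 2, IntegrableOn (a k) (Icc 0 T) := fun k hk => (ha k hk).integrable hα
  have key := fun e c₁ c₂ he => nonneg_combination (e := e) (c₁ := c₁) (c₂ := c₂) hp hT ha' hP hG
    hσ₁ hσ₂ huN huD he
  refine ⟨fun hG0 hσ t ht => ?_, fun hG0 hσ t ht => ?_, fun hG0 hσ t ht => ?_⟩
  · have hs : ∀ t ∈ Icc 0 (2 * T), ∀ s ∈ Icc 0 (2 * T), 0 ≤ (1 : ℝ) * G t s :=
      fun t ht s hs => by linarith [hG0 t ht s hs]
    -- The combinations u_N + u_D and u_N - u_D together bound |u_D|.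
    have h1 := key 1 1 1 (by norm_num) hs (hσ.mono fun s h => by
      obtain ⟨h1, h2⟩ := abs_le.1 h; constructor <;> linarith) t ht
    have h2 := key 1 1 (-1) (by norm_num) hs (hσ.mono fun s h => by
      obtain ⟨h1, h2⟩ := abs_le.1 h; constructor <;> linarith) t ht
    exact abs_le.2 ⟨by linarith, by linarith⟩
  all_goals
    have hs : ∀ t ∈ Icc 0 (2 * T), ∀ s ∈ Icc 0 (2 * T), 0 ≤ (-1 : ℝ) * G t s :=
      fun t ht s hs => by linarith [hG0 t ht s hs]
  -- With `e = -1`, the combinations are -u_N and u_D - u_N; the latter needs σ₁ - σ₂ ≥ 0 and σ₁ +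
  -- σ₂ ≥ 0.
  · have h1 := key (-1) (-1) 0 (by norm_num) hs (hσ.mono fun s h => by
      constructor <;> linarith [h.1, h.2]) t ht
    have h2 := key (-1) (-1) 1 (by norm_num) hs (hσ.mono fun s h => by
      constructor <;> linarith [h.1, h.2]) t ht
    exact ⟨by linarith, by linarith⟩
  -- Now the combinations are u_N and u_N - u_D.
  · have h1 := key (-1) 1 0 (by norm_num) hs (hσ.mono fun s h => by
      constructor <;> linarith [h.1, h.2]) t ht
    have h2 := key (-1) 1 (-1) (by norm_num) hs (hσ.mono fun s h => by
      constructor <;> linarith [h.1, h.2]) t ht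
    exact ⟨by linarith, by linarith⟩
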